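/- For $n\ge 0$ let $\mathcal{M}(n)$ be the set of matchings on $[2n]=\{1,\dots,2n\}$, i.e. of set partitions of $[2n]$ into $n$ two-element blocks (edges). Two edges $A,B$ with $\min A<\min B$ form a crossing if $\min A<\min B<\max A<\max B$ and a nesting if $\min A<\min B<\max B<\max A$. Let $cr_2(M),ne_2(M)\in\mathbb{Z}/2$ be the parities of the numbers of crossings and of nestings of $M$. A child of $M\in\mathcal{M}(n)$ is a matching in $\mathcal{M}(n+1)$ obtained, for some $x\in\{2,\dots,2n+2\}$, by relabelling the points of $M$ increasingly by $\{2,\dots,2n+2\}\setminus\{x\}$ and adding the edge $\{1,x\}$. Let $\mathcal{T}(M,0)=\{M\}$ and let $\mathcal{T}(M,l+1)$ be the set of all children of elements of $\mathcal{T}(M,l)$. For $M,N\in\mathcal{M}(n)$ write $M\sim_{cr,2}N$ (mod-$2$ crossing-similarity) if for every $l\ge 0$ and every $e\in\mathbb{Z}/2$ $$|\{P\in\mathcal{T}(M,l): cr_2(P)=e\}|=|\{P\in\mathcal{T}(N,l): cr_2(P)=e\}|,$$ and define $\sim_{ne,2}$ (mod-$2$ nesting-similarity) in the same way with $ne_2$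 in place of $cr_2$. These are equivalence relations on $\mathcal{M}(n)$. Theorem. We have $|\mathcal{M}(1)/\!\sim_{cr,2}|=1$ and, for every $n\ge 2$, $|\mathcal{M}(n)/\!\sim_{cr,2}|=2$, where the two classes have $\frac{(2n-1)!!+1}{2}$ and $\frac{(2n-1)!!-1}{2}$ elements. We have $|\mathcal{M}(1)/\!\sim_{ne,2}|=1$, $|\mathcal{M}(2)/\!\sim_{ne,2}|=3$, and $|\mathcal{M}(n)/\!\sim_{ne,2}|=2n$ for every $n\ge 3$. -/

import Mathlib

/-- A matching on `2n` linearly ordered points: a set partition of `Fin (2 * n)` (the points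
`1, …, 2n` shifted to `0, …, 2n - 1`) all of whose blocks, called edges, have two elements. -/
abbrev Matching (n : ℕ) : Type :=
  {P : Finpartition (Finset.univ : Finset (Fin (2 * n))) // ∀ e ∈ P.parts, e.card = 2}

namespace Matching

/-- The set of edges of a matching. -/
def edges {n : ℕ} (M : Matching n) : Finset (Finset (Fin (2 * n))) := M.1.parts

/-- `A = {a, c}` and `B = {b, d}` cross, with `A` the block whose minimum is smaller:
`a < b < c < d`. -/
def CrossLeft {m : ℕ} (A B : Finset (Fin m)) : Prop :=
  ∃ a b c d : Fin m, a < b ∧ b < c ∧ c < d ∧ A = {a, c} ∧ B = {b, d}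

/-- `A = {a, d}` and `B = {b, c}` are nested, with `A` the block whose minimum is smaller:
`a < b < c < d`. -/
def NestLeft {m : ℕ} (A B : Finset (Fin m)) : Prop :=
  ∃ a b c d : Fin m, a < b ∧ b < c ∧ c < d ∧ A = {a, d} ∧ B = {b, c}

/-- The number of crossings of `M`. Each unordered pair of crossing edges is counted once,
through its ordering by minima. -/
noncomputable def cr {n : ℕ} (M : Matching n) : ℕ :=
  {p : Finset (Fin (2 * n)) × Finset (Fin (2 * n)) |
    p.1 ∈ M.edges ∧ p.2 ∈ M.edges ∧ CrossLeft p.1 p.2}.ncard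

/-- The number of nestings of `M`. Each unordered pair of nested edges is counted once,
through its ordering by minima. -/
noncomputable def ne {n : ℕ} (M : Matching n) : ℕ :=
  {p : Finset (Fin (2 * n)) × Finset (Fin (2 * n)) |
    p.1 ∈ M.edges ∧ p.2 ∈ M.edges ∧ NestLeft p.1 p.2}.ncard

/-- `cr` modulo two. -/
noncomputable def cr₂ {n : ℕ} (M : Matching n) : ZMod 2 := (M.cr : ZMod 2)

/-- `ne` modulo two. -/
noncomputable def ne₂ {n : ℕ} (M : Matching n) : ZMod 2 := (M.ne : ZMod 2)

/-- The relabelling of the `2n` old points when a new first edge is added: it is the increasing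
bijection onto all of the `2n + 2` new points except the first point and `x.succ`. -/
def relabel {n : ℕ} (x : Fin (2 * n + 1)) (i : Fin (2 * n)) : Fin (2 * (n + 1)) :=
  (x.succAbove i).succ

/-- `N` arises from `M` by adding a new first edge `{first point, x.succ}`. -/
def IsChild {n : ℕ} (M : Matching n) (N : Matching (n + 1)) : Prop :=
  ∃ x : Fin (2 * n + 1),
    N.edges = insert {(0 : Fin (2 * n + 2)), x.succ} (M.edges.image (Finset.image (relabel x)))

/-- The `l`-th level of the subtree, rooted in `M`, of the tree of matchings. -/
def level {n : ℕ} (M : Matching n) : (l : ℕ) → Set (Matching (n + l))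
  | 0 => {M}
  | l + 1 => {N | ∃ P ∈ level M l, IsChild P N}

/-- For a statistic `s` on matchings, `M` and `N` are `s`-similar if, on every level of the
subtrees rooted in `M` and `N`, the statistic `s` takes each value equally often. -/
def Similar {α : Type} (s : ∀ {m : ℕ}, Matching m → α) {n : ℕ} (M N : Matching n) : Prop :=
  ∀ (l : ℕ) (v : α), {P ∈ level M l | s P = v}.ncard = {P ∈ level N l | s P = v}.ncard

/-- Similarity with respect to a statistic, as an equivalence relation. -/
def similarSetoid {α : Type} (s : ∀ {m : ℕ}, Matching m → α) (n : ℕ) : Setoid (Matching n) where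
  r M N := Similar s M N
  iseqv :=
    { refl := fun _ _ _ => rfl
      symm := fun h l v => (h l v).symm
      trans := fun h k l v => (h l v).trans (k l v) }

/-- Crossing-similarity modulo two on the matchings with `n` edges. -/
noncomputable def crSim₂ (n : ℕ) : Setoid (Matching n) := similarSetoid (fun {_} M => cr₂ M) n

/-- Nesting-similarity modulo two on the matchings with `n` edges. -/
noncomputable def neSim₂ (n : ℕ) : Setoid (Matching n) := similarSetoid (fun {_} M => ne₂ M) n

end Matching

/-! Parities are equidistributed on two levels of equal size exactly when the signed counts, sums of
$(-1)^{s(P)}$, agree. So everything reduces to how the sign changes when an edge is added. A child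
of $M$ is indexed by the number $x\in\{0,\dots,2n\}$ of old points enclosed by the new edge.

Crossings: the new edge crosses exactly the old edges with one end among the first $x$ points, and
their number has the parity of $x$. So the sign is multiplied by $(-1)^x$, and
$\sum_{x=0}^{2n}(-1)^x=1$ makes the signed count of each level equal to the sign of the root
(`sum_cr_level`). Only the parity of `cr` matters; summing over all matchings, the two classes
differ in size by 1.

Nestings: the new edge adds `inside x` nestings, so with gap signs $s_k=(-1)^{\mathrm{inside}(k)}$
the signed count of the children is $(-1)^{ne(M)}T$, where $T=\sum_k s_k$ is `total`. A telescoping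
identity (`sum_ne_total_children`) shows that the sum of $(-1)^{ne}T$ over the children is again
$(-1)^{ne(M)}T$. So this is the signed count on every level below the root, and the pair
$((-1)^{ne},T)$ is a complete invariant. It remains to count its values: $T$ is odd and confined to
$n$ values (`total_bounds`), and for $n\ge 3$ each occurs with both signs (`exists_neType_eq`). -/

namespace Matching

open Finset

/-! ### Edges, relabelling and the bijection between matchings and children -/

/-- Every point lies in exactly one edge. -/
theorem existsUnique_edge {n : ℕ} (M : Matching n) (i : Fin (2 * n)) :
    ∃! e, e ∈ M.edges ∧ i ∈ e := by
  simpa [edges] using M.1.existsUnique_mem (mem_univ i)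

theorem card_edge {n : ℕ} (M : Matching n) {e : Finset (Fin (2 * n))} (he : e ∈ M.edges) :
    e.card = 2 := M.2 e he

theorem edge_eq {n : ℕ} (M : Matching n) {e f : Finset (Fin (2 * n))} (he : e ∈ M.edges)
    (hf : f ∈ M.edges) {i : Fin (2 * n)} (hie : i ∈ e) (hif : i ∈ f) : e = f :=
  (M.existsUnique_edge i).unique ⟨he, hie⟩ ⟨hf, hif⟩

theorem edges_injective {n : ℕ} : Function.Injective (edges : Matching n → _) :=
  fun _ _ h => Subtype.ext (Finpartition.ext h)

/-- The matching with a prescribed set of edges. -/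
def ofEdges {n : ℕ} (E : Finset (Finset (Fin (2 * n)))) (h2 : ∀ e ∈ E, e.card = 2)
    (h : ∀ i, ∃! e, e ∈ E ∧ i ∈ e) : Matching n :=
  ⟨Finpartition.ofExistsUnique E (fun _ _ => subset_univ _)
    (fun i _ => by simpa using h i)
    (fun h0 => by simpa using h2 _ h0), h2⟩

@[simp] theorem edges_ofEdges {n : ℕ} (E : Finset (Finset (Fin (2 * n)))) (h2 h) :
    (ofEdges E h2 h).edges = E := rfl

theorem relabel_strictMono {n : ℕ} (x : Fin (2 * n + 1)) : StrictMono (relabel x) :=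
  fun _ _ h => Fin.succ_lt_succ_iff.2 (Fin.strictMono_succAbove x h)

theorem relabel_val {n : ℕ} (x : Fin (2 * n + 1)) (i : Fin (2 * n)) :
    (relabel x i).val = if i.val < x.val then i.val + 1 else i.val + 2 := by
  unfold relabel
  by_cases h : i.val < x.val
  · rw [Fin.succAbove_of_castSucc_lt _ _ (by simpa [Fin.lt_def] using h)]; simp [h]
  · rw [Fin.succAbove_of_le_castSucc _ _ (by simpa [Fin.le_def] using h)]; simp [h]

theorem exists_relabel {n : ℕ} (x : Fin (2 * n + 1)) (j : Fin (2 * n + 2)) (h0 : j ≠ 0)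
    (hx : j ≠ x.succ) : ∃ i, relabel x i = j := by
  obtain ⟨k, rfl⟩ := Fin.exists_succ_eq.2 h0
  obtain ⟨i, hi⟩ := Fin.exists_succAbove_eq (x := k) (y := x) (fun h => hx (by rw [h]))
  exact ⟨i, congrArg Fin.succ hi⟩

theorem relabel_ne_zero {n : ℕ} (x : Fin (2 * n + 1)) (i : Fin (2 * n)) :
    relabel x i ≠ (0 : Fin (2 * n + 2)) := Fin.succ_ne_zero _

theorem relabel_ne_succ {n : ℕ} (x : Fin (2 * n + 1)) (i : Fin (2 * n)) :
    relabel x i ≠ x.succ := fun h => Fin.succAbove_ne x i (Fin.succ_injective _ h)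

/-- The added edge. -/
def newEdge {n : ℕ} (x : Fin (2 * n + 1)) : Finset (Fin (2 * (n + 1))) :=
  {(0 : Fin (2 * n + 2)), x.succ}

theorem relabel_notMem_newEdge {n : ℕ} (x : Fin (2 * n + 1)) (i : Fin (2 * n)) :
    relabel x i ∉ newEdge x := by
  intro h
  rcases mem_insert.1 h with h | h
  · exact relabel_ne_zero x i h
  · exact relabel_ne_succ x i (mem_singleton.1 h)

theorem zero_mem_newEdge {n : ℕ} (x : Fin (2 * n + 1)) :
    (0 : Fin (2 * n + 2)) ∈ newEdge x := mem_insert_self _ _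

theorem succ_mem_newEdge {n : ℕ} (x : Fin (2 * n + 1)) :
    x.succ ∈ newEdge x := mem_insert_of_mem (mem_singleton_self _)

/-- The edges of the child. -/
def childEdges {n : ℕ} (M : Matching n) (x : Fin (2 * n + 1)) :
    Finset (Finset (Fin (2 * (n + 1)))) :=
  insert (newEdge x) (M.edges.image (Finset.image (relabel x)))

theorem image_relabel_injective {n : ℕ} (x : Fin (2 * n + 1)) :
    Function.Injective (Finset.image (relabel x)) :=
  Finset.image_injective (relabel_strictMono x).injective

/-- The child of `M` obtained by adding the edge joining the first point to `x.succ`. -/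
def child {n : ℕ} (M : Matching n) (x : Fin (2 * n + 1)) : Matching (n + 1) :=
  ofEdges (childEdges M x)
    (by
      intro e he
      rcases mem_insert.1 he with rfl | he
      · exact card_pair (Fin.succ_ne_zero x).symm
      · obtain ⟨f, hf, rfl⟩ := mem_image.1 he
        rw [card_image_of_injective _ (relabel_strictMono x).injective, M.card_edge hf])
    (by
      intro j
      by_cases hj : j ∈ newEdge x
      · refine ⟨newEdge x, ⟨mem_insert_self _ _, hj⟩, ?_⟩
        rintro e ⟨he, hje⟩
        rcases mem_insert.1 he with rfl | he
        · rfl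
        · obtain ⟨f, hf, rfl⟩ := mem_image.1 he
          obtain ⟨i, _, rfl⟩ := mem_image.1 hje
          exact absurd hj (relabel_notMem_newEdge x i)
      · obtain ⟨i, rfl⟩ := exists_relabel x j
          (fun h => hj (h ▸ zero_mem_newEdge x)) (fun h => hj (h ▸ succ_mem_newEdge x))
        obtain ⟨f, ⟨hf, hif⟩, hu⟩ := M.existsUnique_edge i
        refine ⟨f.image (relabel x),
          ⟨mem_insert_of_mem (mem_image_of_mem _ hf), mem_image_of_mem _ hif⟩, ?_⟩
        rintro e ⟨he, hje⟩
        rcases mem_insert.1 he with rfl | he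
        · exact absurd hje hj
        · obtain ⟨g, hg, rfl⟩ := mem_image.1 he
          obtain ⟨i', hi', h⟩ := mem_image.1 hje
          rw [(relabel_strictMono x).injective h] at hi'
          rw [hu g ⟨hg, hi'⟩])

theorem edges_child {n : ℕ} (M : Matching n) (x : Fin (2 * n + 1)) :
    (M.child x).edges = insert (newEdge x) (M.edges.image (Finset.image (relabel x))) := rfl

theorem isChild_iff {n : ℕ} {M : Matching n} {N : Matching (n + 1)} :
    IsChild M N ↔ ∃ x, M.child x = N :=
  ⟨fun ⟨x, hx⟩ => ⟨x, edges_injective hx.symm⟩, fun ⟨x, hx⟩ => ⟨x, hx ▸ rfl⟩⟩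

theorem newEdge_notMem_image {n : ℕ} (E : Finset (Finset (Fin (2 * n)))) (x : Fin (2 * n + 1)) :
    newEdge x ∉ E.image (Finset.image (relabel x)) := by
  intro h
  obtain ⟨f, _, hf⟩ := mem_image.1 h
  have h0 := zero_mem_newEdge x
  rw [← hf] at h0
  obtain ⟨i, _, hi⟩ := mem_image.1 h0
  exact relabel_ne_zero x i hi

theorem newEdge_injective {n : ℕ} : Function.Injective (newEdge (n := n)) := by
  intro x y h
  have h1 := succ_mem_newEdge x
  rw [h] at h1
  rcases mem_insert.1 h1 with h1 | h1
  · exact absurd h1 (Fin.succ_ne_zero x)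
  · exact Fin.succ_injective _ (mem_singleton.1 h1)

theorem child_injective {n : ℕ} :
    Function.Injective (fun p : Matching n × Fin (2 * n + 1) => p.1.child p.2) := by
  rintro ⟨M, x⟩ ⟨N, y⟩ h
  have he : (M.child x).edges = (N.child y).edges := congrArg edges h
  have hx : newEdge x ∈ (M.child x).edges := mem_insert_self _ _
  have hy : newEdge y ∈ (M.child x).edges := he ▸ mem_insert_self _ _
  obtain rfl : x = y := newEdge_injective
    (edge_eq _ hx hy (zero_mem_newEdge x) (zero_mem_newEdge y))
  rw [edges_child, edges_child] at he
  have := congrArg (fun E => E.erase (newEdge x)) he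
  simp only [erase_insert (newEdge_notMem_image _ x)] at this
  rw [edges_injective (Finset.image_injective (image_relabel_injective x) this)]

theorem exists_child_eq {n : ℕ} (N : Matching (n + 1)) : ∃ M x, child M x = N := by
  obtain ⟨e, ⟨he, h0⟩, -⟩ := N.existsUnique_edge (0 : Fin (2 * n + 2))
  obtain ⟨x, rfl⟩ : ∃ x, e = newEdge x := by
    obtain ⟨a, b, hab, rfl⟩ := card_eq_two.1 (N.card_edge he)
    rcases mem_insert.1 h0 with h | h
    · subst h
      obtain ⟨x, rfl⟩ := Fin.exists_succ_eq.2 hab.symm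
      exact ⟨x, rfl⟩
    · obtain rfl := mem_singleton.1 h
      obtain ⟨x, rfl⟩ := Fin.exists_succ_eq.2 hab
      exact ⟨x, pair_comm _ _⟩
  have key : ∀ f ∈ N.edges, f ≠ newEdge x →
      ∃ g : Finset (Fin (2 * n)), g.image (relabel x) = f := by
    intro f hf hne
    refine ⟨univ.filter fun i => relabel x i ∈ f, ?_⟩
    ext j
    simp only [mem_image, mem_filter, mem_univ, true_and]
    constructor
    · rintro ⟨i, hi, rfl⟩; exact hi
    · intro hj
      obtain ⟨i, rfl⟩ := exists_relabel x j
        (by rintro rfl; exact hne (N.edge_eq hf he hj h0))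
        (by rintro rfl; exact hne (N.edge_eq hf he hj (succ_mem_newEdge x)))
      exact ⟨i, hj, rfl⟩
  -- The parent is recovered by pulling back the edges of `N` other than the one at the first point.
  let E : Finset (Finset (Fin (2 * n))) := univ.filter fun g => g.image (relabel x) ∈ N.edges
  have hE : ∀ g, g ∈ E ↔ g.image (relabel x) ∈ N.edges := fun g => by simp [E]
  have hinj := (relabel_strictMono x).injective
  refine ⟨ofEdges E ?_ ?_, x, edges_injective ?_⟩
  · intro g hg
    rw [← card_image_of_injective g hinj]
    exact N.card_edge ((hE g).1 hg)
  · intro i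
    obtain ⟨f, ⟨hf, hif⟩, -⟩ := N.existsUnique_edge (relabel x i)
    obtain ⟨g, rfl⟩ := key f hf (fun h => relabel_notMem_newEdge x i (h ▸ hif))
    refine ⟨g, ⟨(hE g).2 hf, (hinj.mem_finset_image).1 hif⟩, ?_⟩
    rintro g' ⟨hg', hi'⟩
    exact image_relabel_injective x
      (N.edge_eq ((hE g').1 hg') hf (mem_image_of_mem _ hi') hif)
  · rw [edges_child, edges_ofEdges]
    ext f
    constructor
    · intro h
      rcases mem_insert.1 h with rfl | h
      · exact he
      · obtain ⟨g, hg, rfl⟩ := mem_image.1 h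
        exact (hE g).1 hg
    · intro hf
      by_cases hne : f = newEdge x
      · rw [hne]; exact mem_insert_self _ _
      · obtain ⟨g, rfl⟩ := key f hf hne
        exact mem_insert_of_mem (mem_image_of_mem _ ((hE g).2 hf))

/-- Matchings with `n + 1` edges are the children of the matchings with `n` edges, each arising
once. -/
noncomputable def childEquiv (n : ℕ) : Matching n × Fin (2 * n + 1) ≃ Matching (n + 1) :=
  Equiv.ofBijective (fun p => p.1.child p.2)
    ⟨child_injective, fun N => let ⟨M, x, h⟩ := exists_child_eq N; ⟨(M, x), h⟩⟩

/-! ### Crossings and nestings created by the new edge -/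

/-- The number of ordered pairs of edges of a child related by `R`. -/
theorem ncard_child_pairs {n : ℕ} (M : Matching n) (x : Fin (2 * n + 1))
    (R : Finset (Fin (2 * (n + 1))) → Finset (Fin (2 * (n + 1))) → Prop)
    (R' : Finset (Fin (2 * n)) → Finset (Fin (2 * n)) → Prop)
    (Q : Finset (Fin (2 * n)) → Prop) [DecidablePred Q]
    (hR : ∀ A, ¬ R A (newEdge x))
    (hR' : ∀ A B, R (A.image (relabel x)) (B.image (relabel x)) ↔ R' A B)
    (hQ : ∀ A ∈ M.edges, R (newEdge x) (A.image (relabel x)) ↔ Q A) :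
    {p : Finset (Fin (2 * (n + 1))) × Finset (Fin (2 * (n + 1))) |
      p.1 ∈ (M.child x).edges ∧ p.2 ∈ (M.child x).edges ∧ R p.1 p.2}.ncard =
    {p : Finset (Fin (2 * n)) × Finset (Fin (2 * n)) |
      p.1 ∈ M.edges ∧ p.2 ∈ M.edges ∧ R' p.1 p.2}.ncard + (M.edges.filter Q).card := by
  have hinj := image_relabel_injective x
  have hnot := newEdge_notMem_image M.edges x
  -- By `hR` the new edge never comes second, so a related pair is either old or has the new edge
  -- first.
  have hset : {p : Finset (Fin (2 * (n + 1))) × Finset (Fin (2 * (n + 1))) |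
      p.1 ∈ (M.child x).edges ∧ p.2 ∈ (M.child x).edges ∧ R p.1 p.2} =
      (Prod.map (Finset.image (relabel x)) (Finset.image (relabel x))) ''
        {p | p.1 ∈ M.edges ∧ p.2 ∈ M.edges ∧ R' p.1 p.2} ∪
      (fun A : Finset (Fin (2 * n)) => (newEdge x, A.image (relabel x))) ''
        ((M.edges.filter Q : Finset (Finset (Fin (2 * n)))) : Set (Finset (Fin (2 * n)))) := by
    ext ⟨A, B⟩
    simp only [edges_child, Set.mem_ofPred_eq, Set.mem_union, Set.mem_image, Prod.exists,
      Prod.map_apply, Prod.mk.injEq, coe_filter, mem_insert, mem_image]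
    constructor
    · rintro ⟨hA, hB, h⟩
      rcases hB with rfl | ⟨B, hB, rfl⟩
      · exact absurd h (hR _)
      · rcases hA with rfl | ⟨A, hA, rfl⟩
        · exact Or.inr ⟨B, ⟨hB, (hQ B hB).1 h⟩, rfl, rfl⟩
        · exact Or.inl ⟨A, B, ⟨hA, hB, (hR' A B).1 h⟩, rfl, rfl⟩
    · rintro (⟨A, B, ⟨hA, hB, h⟩, rfl, rfl⟩ | ⟨B, ⟨hB, h⟩, rfl, rfl⟩)
      · exact ⟨Or.inr ⟨A, hA, rfl⟩, Or.inr ⟨B, hB, rfl⟩, (hR' A B).2 h⟩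
      · exact ⟨Or.inl rfl, Or.inr ⟨B, hB, rfl⟩, (hQ B hB).2 h⟩
  rw [hset, Set.ncard_union_eq _ (Set.toFinite _) (Set.toFinite _),
    Set.ncard_image_of_injective _ (hinj.prodMap hinj),
    Set.ncard_image_of_injective _ (fun A B h => hinj (Prod.mk.inj h).2), Set.ncard_coe_finset]
  rw [Set.disjoint_left]
  rintro _ ⟨⟨A, B⟩, ⟨hA, _, _⟩, rfl⟩ ⟨C, _, h⟩
  exact hnot ((Prod.mk.inj h).1 ▸ mem_image_of_mem _ hA)

theorem image_eq_pair {α β : Type*} [DecidableEq α] [DecidableEq β] {f : α → β}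
    (hf : Function.Injective f) {A : Finset α} {a b : β} (h : A.image f = {a, b}) :
    ∃ a' b', a = f a' ∧ b = f b' ∧ A = {a', b'} := by
  obtain ⟨a', _, rfl⟩ := mem_image.1 (h ▸ mem_insert_self a {b} : a ∈ A.image f)
  obtain ⟨b', _, rfl⟩ := mem_image.1
    (h ▸ mem_insert_of_mem (mem_singleton_self b) : b ∈ A.image f)
  exact ⟨a', b', rfl, rfl, Finset.image_injective hf (by rw [h, image_insert, image_singleton])⟩

theorem nestLeft_image {m k : ℕ} {f : Fin m → Fin k} (hf : StrictMono f) (A B : Finset (Fin m)) :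
    NestLeft (A.image f) (B.image f) ↔ NestLeft A B := by
  constructor
  · rintro ⟨a, b, c, d, h1, h2, h3, hA, hB⟩
    obtain ⟨a, d, rfl, rfl, rfl⟩ := image_eq_pair hf.injective hA
    obtain ⟨b, c, rfl, rfl, rfl⟩ := image_eq_pair hf.injective hB
    exact ⟨a, b, c, d, hf.lt_iff_lt.1 h1, hf.lt_iff_lt.1 h2, hf.lt_iff_lt.1 h3, rfl, rfl⟩
  · rintro ⟨a, b, c, d, h1, h2, h3, rfl, rfl⟩
    exact ⟨f a, f b, f c, f d, hf h1, hf h2, hf h3, by simp [image_insert], by simp [image_insert]⟩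

theorem crossLeft_image {m k : ℕ} {f : Fin m → Fin k} (hf : StrictMono f)
    (A B : Finset (Fin m)) : CrossLeft (A.image f) (B.image f) ↔ CrossLeft A B := by
  constructor
  · rintro ⟨a, b, c, d, h1, h2, h3, hA, hB⟩
    obtain ⟨a, c, rfl, rfl, rfl⟩ := image_eq_pair hf.injective hA
    obtain ⟨b, d, rfl, rfl, rfl⟩ := image_eq_pair hf.injective hB
    exact ⟨a, b, c, d, hf.lt_iff_lt.1 h1, hf.lt_iff_lt.1 h2, hf.lt_iff_lt.1 h3, rfl, rfl⟩
  · rintro ⟨a, b, c, d, h1, h2, h3, rfl, rfl⟩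
    exact ⟨f a, f b, f c, f d, hf h1, hf h2, hf h3, by simp [image_insert], by simp [image_insert]⟩

theorem exists_pair_of_card_two {m : ℕ} {A : Finset (Fin m)} (h : A.card = 2) :
    ∃ b c, b < c ∧ A = {b, c} := by
  obtain ⟨b, c, hbc, rfl⟩ := card_eq_two.1 h
  rcases lt_or_gt_of_ne hbc with h | h
  · exact ⟨b, c, h, rfl⟩
  · exact ⟨c, b, h, pair_comm _ _⟩

theorem pair_eq_pair_of_lt {α : Type*} [LinearOrder α] {a b c d : α} (hab : a < b) (hcd : c < d)
    (h : ({a, b} : Finset α) = {c, d}) : a = c ∧ b = d := by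
  have ha : a ∈ ({c, d} : Finset α) := h ▸ mem_insert_self _ _
  have hb : b ∈ ({c, d} : Finset α) := h ▸ mem_insert_of_mem (mem_singleton_self _)
  have hc : c ∈ ({a, b} : Finset α) := h ▸ mem_insert_self _ _
  have hd : d ∈ ({a, b} : Finset α) := h ▸ mem_insert_of_mem (mem_singleton_self _)
  simp only [mem_insert, mem_singleton] at ha hb hc hd
  rcases ha with rfl | rfl <;> rcases hb with rfl | rfl
  · exact absurd hab (lt_irrefl _)
  · exact ⟨rfl, rfl⟩
  · exact absurd hab hcd.not_gt
  · exact absurd hab (lt_irrefl _)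

theorem zero_lt_succ' {n : ℕ} (x : Fin (2 * n + 1)) :
    (0 : Fin (2 * n + 2)) < x.succ := Fin.succ_pos x

theorem not_nestLeft_newEdge {n : ℕ} (x : Fin (2 * n + 1)) (A : Finset (Fin (2 * (n + 1)))) :
    ¬ NestLeft A (newEdge x) := by
  rintro ⟨a, b, c, d, h1, h2, h3, -, h⟩
  obtain ⟨rfl, -⟩ := pair_eq_pair_of_lt (zero_lt_succ' x) h2 h
  exact absurd h1 (Fin.not_lt_zero a)

theorem not_crossLeft_newEdge {n : ℕ} (x : Fin (2 * n + 1)) (A : Finset (Fin (2 * (n + 1)))) :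
    ¬ CrossLeft A (newEdge x) := by
  rintro ⟨a, b, c, d, h1, h2, h3, -, h⟩
  obtain ⟨rfl, -⟩ := pair_eq_pair_of_lt (zero_lt_succ' x) (h2.trans h3) h
  exact absurd h1 (Fin.not_lt_zero a)

theorem relabel_lt_succ {n : ℕ} (x : Fin (2 * n + 1)) (i : Fin (2 * n)) :
    relabel x i < (x.succ : Fin (2 * n + 2)) ↔ i.val < x.val := by
  rw [Fin.lt_def, relabel_val, Fin.val_succ]; split_ifs <;> omega

theorem zero_lt_relabel {n : ℕ} (x : Fin (2 * n + 1)) (i : Fin (2 * n)) :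
    (0 : Fin (2 * n + 2)) < relabel x i := Fin.pos_of_ne_zero (relabel_ne_zero x i)

theorem succ_lt_relabel {n : ℕ} (x : Fin (2 * n + 1)) (i : Fin (2 * n)) :
    (x.succ : Fin (2 * n + 2)) < relabel x i ↔ x.val ≤ i.val := by
  rw [Fin.lt_def, relabel_val, Fin.val_succ]; split_ifs <;> omega

theorem newEdge_nestLeft_iff {n : ℕ} (x : Fin (2 * n + 1)) {A : Finset (Fin (2 * n))}
    (hA : A.card = 2) :
    NestLeft (newEdge x) (A.image (relabel x)) ↔ ∀ i ∈ A, i.val < x.val := by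
  obtain ⟨b, c, hbc, rfl⟩ := exists_pair_of_card_two hA
  rw [image_insert, image_singleton]
  have hm := relabel_strictMono x hbc
  constructor
  · rintro ⟨a, b', c', d, h1, h2, h3, hN, hI⟩
    obtain ⟨rfl, rfl⟩ := pair_eq_pair_of_lt (zero_lt_succ' x) (h1.trans (h2.trans h3)) hN
    obtain ⟨rfl, rfl⟩ := pair_eq_pair_of_lt hm h2 hI
    have := (relabel_lt_succ x c).1 h3
    intro i hi
    rcases mem_insert.1 hi with rfl | hi
    · exact lt_trans hbc this
    · rw [mem_singleton.1 hi]; exact this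
  · intro h
    exact ⟨(0 : Fin (2 * n + 2)), relabel x b, relabel x c, x.succ, zero_lt_relabel x b, hm,
      (relabel_lt_succ x c).2 (h c (by simp)), rfl, rfl⟩

/-- An edge has 0, 1 or 2 ends below $x$, and crossing means exactly 1. Phrasing this as oddness
lets `cr_child` find the parity by summing over edges. -/
theorem newEdge_crossLeft_iff {n : ℕ} (x : Fin (2 * n + 1)) {A : Finset (Fin (2 * n))}
    (hA : A.card = 2) :
    CrossLeft (newEdge x) (A.image (relabel x)) ↔ Odd (A.filter fun i => i.val < x.val).card := by
  obtain ⟨b, c, hbc, rfl⟩ := exists_pair_of_card_two hA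
  rw [image_insert, image_singleton]
  have hm := relabel_strictMono x hbc
  have hbc' : b.val < c.val := hbc
  have hne : b ≠ c := hbc.ne
  have h1 : CrossLeft (newEdge x) {relabel x b, relabel x c} ↔ b.val < x.val ∧ x.val ≤ c.val := by
    constructor
    · rintro ⟨a, b', c', d, h1, h2, h3, hN, hI⟩
      obtain ⟨rfl, rfl⟩ := pair_eq_pair_of_lt (zero_lt_succ' x) (h1.trans h2) hN
      obtain ⟨rfl, rfl⟩ := pair_eq_pair_of_lt hm (h2.trans h3) hI
      exact ⟨(relabel_lt_succ x b).1 h2, (succ_lt_relabel x c).1 h3⟩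
    · rintro ⟨h1, h2⟩
      exact ⟨(0 : Fin (2 * n + 2)), relabel x b, x.succ, relabel x c, zero_lt_relabel x b,
        (relabel_lt_succ x b).2 h1, (succ_lt_relabel x c).2 h2, rfl, rfl⟩
  rw [h1, filter_insert, filter_singleton]
  by_cases hb : b.val < x.val <;> by_cases hc : c.val < x.val
  · simp [hb, hc, hne, Nat.not_le.2 hc]
  · simp [hb, hc, Nat.not_lt.1 hc]
  · omega
  · simp [hb, hc]

/-! ### The function `inside`, and the effect of a child on it -/

/-- The number of edges among the first `k` points. -/
def inside {n : ℕ} (M : Matching n) (k : ℕ) : ℕ :=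
  (M.edges.filter fun e => ∀ i ∈ e, i.val < k).card

theorem ne_child {n : ℕ} (M : Matching n) (x : Fin (2 * n + 1)) :
    (M.child x).ne = M.ne + M.inside x :=
  ncard_child_pairs M x _ _ _ (not_nestLeft_newEdge x) (nestLeft_image (relabel_strictMono x))
    fun _ hA => newEdge_nestLeft_iff x (M.card_edge hA)

/-- The first `k` points, counted edge by edge. -/
theorem sum_card_filter_lt {n : ℕ} (M : Matching n) {k : ℕ} (hk : k ≤ 2 * n) :
    ∑ e ∈ M.edges, (e.filter fun i => i.val < k).card = k := by
  have h : (univ.filter fun i : Fin (2 * n) => i.val < k).card = k := by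
    rw [Fin.card_filter_val_lt]; omega
  conv_rhs => rw [← h]
  rw [← card_biUnion]
  · congr 1
    ext i
    obtain ⟨e, ⟨he, hi⟩, -⟩ := M.existsUnique_edge i
    simp only [mem_biUnion, mem_filter, mem_univ, true_and]
    exact ⟨fun ⟨_, _, h⟩ => h.2, fun h => ⟨e, he, hi, h⟩⟩
  · intro e he f hf hne
    rw [Function.onFun, disjoint_left]
    intro i hi hi'
    exact hne (M.edge_eq he hf (mem_filter.1 hi).1 (mem_filter.1 hi').1)

theorem cr_child {n : ℕ} (M : Matching n) (x : Fin (2 * n + 1)) :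
    (-1 : ℤ) ^ (M.child x).cr = (-1) ^ M.cr * (-1) ^ x.val := by
  have h : (M.child x).cr = M.cr +
      (M.edges.filter fun e => Odd (e.filter fun i => i.val < x.val).card).card :=
    ncard_child_pairs M x _ _ _ (not_crossLeft_newEdge x)
      (crossLeft_image (relabel_strictMono x))
      fun _ hA => newEdge_crossLeft_iff x (M.card_edge hA)
  rw [h, pow_add]
  congr 1
  apply neg_one_pow_congr
  -- The number of odd summands has the parity of the sum, which is $x$.
  rw [← even_sum_iff_even_card_odd, M.sum_card_filter_lt (by omega)]

theorem inside_zero {n : ℕ} (M : Matching n) : M.inside 0 = 0 := by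
  rw [inside, card_eq_zero, filter_eq_empty_iff]
  intro e he h
  obtain ⟨b, c, _, rfl⟩ := exists_pair_of_card_two (M.card_edge he)
  exact absurd (h b (by simp)) (Nat.not_lt_zero _)

theorem inside_child {n : ℕ} (M : Matching n) (x : Fin (2 * n + 1)) (m : ℕ) :
    (M.child x).inside m = (M.edges.filter fun e => ∀ i ∈ e, (relabel x i).val < m).card +
      if x.val + 1 < m then 1 else 0 := by
  have h : (∀ i ∈ newEdge x, i.val < m) ↔ x.val + 1 < m := by
    constructor
    · intro h; simpa using h _ (succ_mem_newEdge x)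
    · intro h i hi
      rcases mem_insert.1 hi with rfl | hi
      · exact lt_of_le_of_lt (Nat.zero_le _) h
      · rw [mem_singleton.1 hi]; simpa using h
  have h2 : ((M.edges.image (Finset.image (relabel x))).filter fun e => ∀ i ∈ e, i.val < m) =
      (M.edges.filter fun e => ∀ i ∈ e, (relabel x i).val < m).image
        (Finset.image (relabel x)) := by
    rw [filter_image]; simp
  rw [inside, edges_child, filter_insert]
  simp only [h]
  split_ifs
  · rw [card_insert_of_notMem (fun hmem => newEdge_notMem_image _ x (mem_filter.1 hmem).1), h2,
      card_image_of_injective _ (image_relabel_injective x)]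
  · rw [h2, card_image_of_injective _ (image_relabel_injective x), add_zero]

/-- Up to the far end of the new edge, only the new first point intervenes: indices shift by 1 and
no edge is gained. Beyond it, in `inside_child_of_ge`, they shift by 2 and the new edge counts. Gap
$x$ of the parent is thus split into gaps $x+1$ and $x+2$. -/
theorem inside_child_of_le {n : ℕ} (M : Matching n) (x : Fin (2 * n + 1)) {j : ℕ}
    (hj : j ≤ x.val) : (M.child x).inside (j + 1) = M.inside j := by
  rw [inside_child, if_neg (by omega), add_zero, inside]
  congr 1
  refine filter_congr fun e _ => forall₂_congr fun i _ => ?_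
  rw [relabel_val]; split_ifs <;> omega

theorem inside_child_of_ge {n : ℕ} (M : Matching n) (x : Fin (2 * n + 1)) {j : ℕ}
    (hj : x.val ≤ j) : (M.child x).inside (j + 2) = M.inside j + 1 := by
  rw [inside_child, if_pos (by omega), inside]
  congr 2
  refine filter_congr fun e _ => forall₂_congr fun i _ => ?_
  rw [relabel_val]; split_ifs <;> omega

theorem edges_zero (M : Matching 0) : M.edges = ∅ := by
  rw [eq_empty_iff_forall_notMem]
  intro e he
  obtain ⟨b, _⟩ := exists_pair_of_card_two (M.card_edge he)
  exact b.elim0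

theorem inside_of_le {n : ℕ} (M : Matching n) : M.inside (2 * n) = n := by
  induction n with
  | zero => exact M.inside_zero
  | succ n ih =>
    obtain ⟨M, x, rfl⟩ := exists_child_eq M
    rw [show 2 * (n + 1) = 2 * n + 2 by ring, inside_child_of_ge _ _ (by omega), ih]

theorem inside_one {n : ℕ} (M : Matching (n + 1)) : M.inside 1 = 0 := by
  obtain ⟨M, x, rfl⟩ := exists_child_eq M
  rw [inside_child_of_le M x (Nat.zero_le _), inside_zero]

theorem inside_step {n : ℕ} (M : Matching n) {k : ℕ} (hk : k < 2 * n) :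
    M.inside (k + 1) = M.inside k ∨ M.inside (k + 1) = M.inside k + 1 := by
  induction n generalizing k with
  | zero => omega
  | succ n ih =>
    obtain ⟨M, x, rfl⟩ := exists_child_eq M
    rcases k with _ | k
    · rw [inside_one, inside_zero]; simp
    · rcases lt_trichotomy k x.val with h | h | h
      · rw [inside_child_of_le M x h, inside_child_of_le M x h.le]
        exact ih M (by omega)
      · rw [inside_child_of_ge M x h.ge, inside_child_of_le M x h.le]; simp
      · obtain ⟨k, rfl⟩ : ∃ j, k = j + 1 := ⟨k - 1, by omega⟩
        rw [inside_child_of_ge M x h.le, inside_child_of_ge M x (by omega)]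
        rcases ih M (k := k) (by omega) with h | h <;> simp [h]

/-! ### Levels as finsets, and similarity through signed counts -/

/-- The `l`-th level of the subtree rooted in `M`, as a finset. -/
noncomputable def levelFinset {n : ℕ} (M : Matching n) : (l : ℕ) → Finset (Matching (n + l))
  | 0 => {M}
  | l + 1 => (levelFinset M l ×ˢ (univ : Finset (Fin (2 * (n + l) + 1)))).map
      (childEquiv (n + l)).toEmbedding

theorem coe_levelFinset {n : ℕ} (M : Matching n) (l : ℕ) :
    (levelFinset M l : Set (Matching (n + l))) = level M l := by
  induction l with
  | zero => simp [levelFinset, level]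
  | succ l ih =>
    ext N
    simp only [levelFinset, level, mem_coe, mem_map, mem_product, mem_univ, and_true,
      Prod.exists, Set.mem_ofPred_eq, ← ih]
    constructor
    · rintro ⟨P, x, hP, rfl⟩
      exact ⟨P, hP, isChild_iff.2 ⟨x, rfl⟩⟩
    · rintro ⟨P, hP, h⟩
      obtain ⟨x, rfl⟩ := isChild_iff.1 h
      exact ⟨P, x, hP, rfl⟩

theorem sum_levelFinset_succ {n : ℕ} (M : Matching n) (l : ℕ) (f : Matching (n + l + 1) → ℤ) :
    ∑ P ∈ levelFinset M (l + 1), f P =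
      ∑ P ∈ levelFinset M l, ∑ x : Fin (2 * (n + l) + 1), f (P.child x) := by
  rw [← sum_product', levelFinset, sum_map]
  rfl

theorem card_levelFinset {n : ℕ} (M N : Matching n) (l : ℕ) :
    (levelFinset M l).card = (levelFinset N l).card := by
  induction l with
  | zero => simp [levelFinset]
  | succ l ih => simp only [levelFinset, card_map, card_product, ih]

theorem zmod_two_eq_zero_or_one (v : ZMod 2) : v = 0 ∨ v = 1 := by
  revert v; decide

theorem neg_one_pow_eq_ite (k : ℕ) : (-1 : ℤ) ^ k = if (k : ZMod 2) = 0 then 1 else -1 := by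
  rcases Nat.even_or_odd k with h | h
  · rw [h.neg_one_pow, if_pos (ZMod.natCast_eq_zero_iff_even.2 h)]
  · rw [h.neg_one_pow, if_neg (fun h0 => Nat.not_even_iff_odd.2 h
      (ZMod.natCast_eq_zero_iff_even.1 h0))]

/-- A parity is equidistributed on two finsets of equal size iff its signed counts agree. -/
theorem card_filter_parity_eq_iff {α : Type*} (s t : Finset α) (f : α → ℕ)
    (h : s.card = t.card) :
    (∀ v : ZMod 2, (s.filter fun a => (f a : ZMod 2) = v).card =
      (t.filter fun a => (f a : ZMod 2) = v).card) ↔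
    ∑ a ∈ s, (-1 : ℤ) ^ f a = ∑ a ∈ t, (-1 : ℤ) ^ f a := by
  have hsum : ∀ u : Finset α, ∑ a ∈ u, (-1 : ℤ) ^ f a =
      2 * (u.filter fun a => (f a : ZMod 2) = 0).card - u.card := by
    intro u
    rw [card_filter, card_eq_sum_ones, Nat.cast_sum, Nat.cast_sum, mul_sum, ← sum_sub_distrib]
    refine sum_congr rfl fun a _ => ?_
    rw [neg_one_pow_eq_ite]
    split_ifs <;> simp
  have hone : ∀ u : Finset α, (u.filter fun a => (f a : ZMod 2) = 0).card +
      (u.filter fun a => (f a : ZMod 2) = 1).card = u.card := by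
    intro u
    rw [← card_filter_add_card_filter_not (s := u) (fun a => (f a : ZMod 2) = 0)]
    congr 2
    refine filter_congr fun a _ => ?_
    generalize (f a : ZMod 2) = v
    revert v; decide
  rw [hsum, hsum]
  have hs := hone s
  have ht := hone t
  constructor
  · intro hv
    rw [hv 0, h]
  · intro hv v
    rcases zmod_two_eq_zero_or_one v with rfl | rfl <;> omega

theorem similar_iff_sum {n : ℕ} (st : ∀ {m : ℕ}, Matching m → ℕ) (M N : Matching n) :
    Similar (fun {_} P => (st P : ZMod 2)) M N ↔
      ∀ l, ∑ P ∈ levelFinset M l, (-1 : ℤ) ^ st P = ∑ P ∈ levelFinset N l, (-1 : ℤ) ^ st P := by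
  refine forall_congr' fun l => ?_
  rw [← card_filter_parity_eq_iff _ _ _ (card_levelFinset M N l)]
  refine forall_congr' fun v => ?_
  rw [← Set.ncard_coe_finset, ← Set.ncard_coe_finset, coe_filter, coe_filter]
  simp only [← mem_coe, coe_levelFinset]

/-! ### Crossing-similarity -/

theorem sum_range_neg_one_pow (n : ℕ) : ∑ x : Fin (2 * n + 1), (-1 : ℤ) ^ x.val = 1 := by
  rw [Fin.sum_univ_eq_sum_range (fun i => (-1 : ℤ) ^ i)]
  induction n with
  | zero => simp
  | succ n ih =>
    rw [show 2 * (n + 1) + 1 = 2 * n + 1 + 1 + 1 by ring, sum_range_succ, sum_range_succ, ih]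
    simp [pow_succ]

theorem sum_cr_children {n : ℕ} (M : Matching n) :
    ∑ x, (-1 : ℤ) ^ (M.child x).cr = (-1) ^ M.cr := by
  simp only [cr_child, ← mul_sum, sum_range_neg_one_pow, mul_one]

theorem sum_cr_level {n : ℕ} (M : Matching n) (l : ℕ) :
    ∑ P ∈ levelFinset M l, (-1 : ℤ) ^ P.cr = (-1) ^ M.cr := by
  induction l with
  | zero => simp [levelFinset]
  | succ l ih =>
    rw [sum_levelFinset_succ M l (fun P => (-1 : ℤ) ^ P.cr), ← ih]
    exact sum_congr rfl fun P _ => sum_cr_children P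

theorem crSim₂_iff {n : ℕ} (M N : Matching n) :
    crSim₂ n M N ↔ (-1 : ℤ) ^ M.cr = (-1) ^ N.cr := by
  change Similar (fun {_} P => ((cr P : ℕ) : ZMod 2)) M N ↔ _
  rw [similar_iff_sum]
  simp only [sum_cr_level, forall_const]

/-! ### Gap signs and nesting-similarity -/

/-- The sign attached to the `k`-th gap. -/
noncomputable def gapSign {n : ℕ} (M : Matching n) (k : ℕ) : ℤ := (-1) ^ M.inside k

/-- The sum of the first `k` gap signs. -/
noncomputable def gapSum {n : ℕ} (M : Matching n) (k : ℕ) : ℤ := ∑ j ∈ range k, M.gapSign j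

/-- The sum of all gap signs. -/
noncomputable def total {n : ℕ} (M : Matching n) : ℤ := M.gapSum (2 * n + 1)

theorem gapSum_succ {n : ℕ} (M : Matching n) (k : ℕ) :
    M.gapSum (k + 1) = M.gapSum k + M.gapSign k := sum_range_succ _ _

@[simp] theorem gapSum_zero {n : ℕ} (M : Matching n) : M.gapSum 0 = 0 := rfl

@[simp] theorem gapSign_zero {n : ℕ} (M : Matching n) : M.gapSign 0 = 1 := by
  rw [gapSign, inside_zero, pow_zero]

theorem gapSign_one {n : ℕ} (M : Matching (n + 1)) : M.gapSign 1 = 1 := by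
  rw [gapSign, inside_one, pow_zero]

theorem gapSign_last {n : ℕ} (M : Matching n) : M.gapSign (2 * n) = (-1) ^ n := by
  rw [gapSign, inside_of_le]

/-- The gap signs of the child are $1$, then $s_0,\dots,s_x$, then $-s_x,\dots,-s_{2n}$, with $s_x$
used twice. -/
theorem total_child {n : ℕ} (M : Matching n) (x : Fin (2 * n + 1)) :
    (M.child x).total = 1 + M.gapSum (x + 1) + M.gapSum x - M.total := by
  have h : ∀ m, x.val ≤ m →
      (M.child x).gapSum (m + 2) = 1 + M.gapSum (x + 1) + M.gapSum x - M.gapSum m := by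
    intro m hm
    induction m, hm using Nat.le_induction with
    | base =>
      rw [gapSum, sum_range_succ', gapSign_zero, add_sub_cancel_right, add_comm]
      congr 1
      refine sum_congr rfl fun j hj => ?_
      rw [gapSign, inside_child_of_le M x (Nat.lt_succ_iff.1 (mem_range.1 hj)), gapSign]
    | succ m hm ih =>
      rw [show m + 1 + 2 = m + 2 + 1 by ring, gapSum_succ, ih, gapSum_succ M m, gapSign,
        inside_child_of_ge M x hm, gapSign]
      ring
  exact h (2 * n + 1) (by omega)

theorem sign_child {n : ℕ} (M : Matching n) (x : Fin (2 * n + 1)) :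
    (-1 : ℤ) ^ (M.child x).ne = (-1) ^ M.ne * M.gapSign x := by
  rw [ne_child, pow_add, gapSign]

theorem sum_ne_children {n : ℕ} (M : Matching n) :
    ∑ x, (-1 : ℤ) ^ (M.child x).ne = (-1) ^ M.ne * M.total := by
  simp only [sign_child, ← mul_sum]
  rw [Fin.sum_univ_eq_sum_range (fun i => M.gapSign i)]
  rfl

/-- With $G_k$ the partial sums, $s_k(G_{k+1}+G_k)=G_{k+1}^2-G_k^2$ telescopes. The whole sum is
$T(1-T)+T^2=T$, up to the sign of $M$. -/
theorem sum_ne_total_children {n : ℕ} (M : Matching n) :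
    ∑ x, (-1 : ℤ) ^ (M.child x).ne * (M.child x).total = (-1) ^ M.ne * M.total := by
  have h : ∀ m, ∑ k ∈ range m, M.gapSign k *
      (1 + M.gapSum (k + 1) + M.gapSum k - M.total) =
      M.gapSum m * (1 - M.total) + M.gapSum m ^ 2 := by
    intro m
    induction m with
    | zero => simp
    | succ m ih => rw [sum_range_succ, ih, gapSum_succ]; ring
  simp only [sign_child, total_child, mul_assoc, ← mul_sum]
  rw [Fin.sum_univ_eq_sum_range
    (fun k => M.gapSign k * (1 + M.gapSum (k + 1) + M.gapSum k - M.total)), h]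
  rw [total]; ring

theorem sum_ne_total_level {n : ℕ} (M : Matching n) (l : ℕ) :
    ∑ P ∈ levelFinset M l, (-1 : ℤ) ^ P.ne * P.total = (-1) ^ M.ne * M.total := by
  induction l with
  | zero => simp [levelFinset]
  | succ l ih =>
    rw [sum_levelFinset_succ M l (fun P => (-1 : ℤ) ^ P.ne * P.total), ← ih]
    exact sum_congr rfl fun P _ => sum_ne_total_children P

theorem sum_ne_level_succ {n : ℕ} (M : Matching n) (l : ℕ) :
    ∑ P ∈ levelFinset M (l + 1), (-1 : ℤ) ^ P.ne = (-1) ^ M.ne * M.total := by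
  rw [sum_levelFinset_succ M l (fun P => (-1 : ℤ) ^ P.ne), ← sum_ne_total_level M l]
  exact sum_congr rfl fun P _ => sum_ne_children P

/-- The complete invariant of nesting-similarity modulo two. -/
noncomputable def neType {n : ℕ} (M : Matching n) : ℤ × ℤ := ((-1) ^ M.ne, M.total)

/-- Level 0 determines the sign and level 1 then determines `total`; all later levels repeat level
1. -/
theorem neSim₂_iff {n : ℕ} (M N : Matching n) : neSim₂ n M N ↔ M.neType = N.neType := by
  change Similar (fun {_} P => ((ne P : ℕ) : ZMod 2)) M N ↔ _
  rw [similar_iff_sum, neType, neType, Prod.mk.injEq]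
  constructor
  · intro h
    have h0 : (-1 : ℤ) ^ M.ne = (-1) ^ N.ne := by simpa [levelFinset] using h 0
    have h1 := h 1
    rw [sum_ne_level_succ, sum_ne_level_succ, h0] at h1
    exact ⟨h0, mul_left_cancel₀ (pow_ne_zero _ (by norm_num)) h1⟩
  · rintro ⟨h0, h1⟩ l
    cases l with
    | zero => simpa [levelFinset] using h0
    | succ l => rw [sum_ne_level_succ, sum_ne_level_succ, h0, h1]

/-! ### Counting matchings and crossing classes -/

theorem card_quotient_of_iff {α β : Type*} (s : Setoid α) (f : α → β)
    (h : ∀ a b, s a b ↔ f a = f b) : Nat.card (Quotient s) = (Set.range f).ncard := by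
  obtain rfl : s = Setoid.ker f := Setoid.ext h
  exact Nat.card_congr (Setoid.quotientKerEquivRange f)

instance : Unique (Matching 0) where
  default := ofEdges ∅ (by simp) (fun i => i.elim0)
  uniq M := edges_injective (by rw [edges_zero, edges_ofEdges])

theorem card_matching_succ (n : ℕ) :
    Fintype.card (Matching (n + 1)) = Fintype.card (Matching n) * (2 * n + 1) := by
  rw [← Fintype.card_congr (childEquiv n), Fintype.card_prod, Fintype.card_fin]

theorem card_matching (n : ℕ) :
    Fintype.card (Matching n) = Nat.doubleFactorial (2 * n - 1) := by
  induction n with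
  | zero => rw [Fintype.card_unique]; rfl
  | succ n ih =>
    rw [card_matching_succ, ih]
    cases n with
    | zero => rfl
    | succ n =>
      rw [show 2 * (n + 1 + 1) - 1 = 2 * n + 1 + 2 by omega, Nat.doubleFactorial_add_two, mul_comm]
      rfl

theorem sum_cr_univ (n : ℕ) : ∑ M : Matching n, (-1 : ℤ) ^ M.cr = 1 := by
  induction n with
  | zero =>
    rw [Fintype.sum_unique]
    have : (default : Matching 0).cr = 0 := by
      rw [cr, edges_zero]; simp
    rw [this, pow_zero]
  | succ n ih =>
    rw [← Equiv.sum_comp (childEquiv n), Fintype.sum_prod_type]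
    refine Eq.trans ?_ ih
    exact sum_congr rfl fun M _ => sum_cr_children M

theorem card_cr_even_odd (n : ℕ) :
    ({M : Matching n | (-1 : ℤ) ^ M.cr = 1}.ncard : ℤ) +
      {M : Matching n | (-1 : ℤ) ^ M.cr = -1}.ncard = Nat.doubleFactorial (2 * n - 1) ∧
    ({M : Matching n | (-1 : ℤ) ^ M.cr = 1}.ncard : ℤ) -
      {M : Matching n | (-1 : ℤ) ^ M.cr = -1}.ncard = 1 := by
  have hA : ∀ z : ℤ, ({M : Matching n | (-1 : ℤ) ^ M.cr = z}.ncard : ℤ) =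
      ∑ M : Matching n, if (-1 : ℤ) ^ M.cr = z then 1 else 0 := by
    intro z
    rw [Set.ncard_eq_toFinset_card', Set.toFinset_ofPred, card_filter, Nat.cast_sum]
    exact sum_congr rfl fun M _ => by split_ifs <;> rfl
  rw [hA, hA, ← sum_add_distrib, ← sum_sub_distrib, ← card_matching,
    Fintype.card_eq_sum_ones, Nat.cast_sum]
  refine ⟨sum_congr rfl fun M _ => ?_, Eq.trans (sum_congr rfl fun M _ => ?_) (sum_cr_univ n)⟩ <;>
    rcases neg_one_pow_eq_or ℤ M.cr with h | h <;> rw [h] <;> norm_num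

theorem crSim₂_class {n : ℕ} (M : Matching n) :
    {N : Matching n | Quotient.mk (crSim₂ n) N = Quotient.mk (crSim₂ n) M} =
      {N : Matching n | (-1 : ℤ) ^ N.cr = (-1) ^ M.cr} := by
  ext N
  exact Quotient.eq.trans (crSim₂_iff N M)

theorem three_le_doubleFactorial {n : ℕ} (hn : 2 ≤ n) : 3 ≤ Nat.doubleFactorial (2 * n - 1) := by
  obtain ⟨k, rfl⟩ := Nat.exists_eq_add_of_le hn
  rw [show 2 * (2 + k) - 1 = 2 * k + 1 + 2 by omega, Nat.doubleFactorial_add_two]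
  have := Nat.doubleFactorial_pos (2 * k + 1)
  nlinarith

/-- The two counts differ by 1 and add up to at least 3, so neither vanishes. -/
theorem exists_cr_sign {n : ℕ} (hn : 2 ≤ n) :
    (∃ M : Matching n, (-1 : ℤ) ^ M.cr = 1) ∧ ∃ M : Matching n, (-1 : ℤ) ^ M.cr = -1 := by
  obtain ⟨h1, h2⟩ := card_cr_even_odd n
  have h3 := three_le_doubleFactorial hn
  have hA : {M : Matching n | (-1 : ℤ) ^ M.cr = 1}.ncard ≠ 0 := fun h => by
    rw [h] at h1 h2; omega
  have hB : {M : Matching n | (-1 : ℤ) ^ M.cr = -1}.ncard ≠ 0 := fun h => by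
    rw [h] at h1 h2; omega
  exact ⟨Set.nonempty_of_ncard_ne_zero hA, Set.nonempty_of_ncard_ne_zero hB⟩

theorem card_crSim₂ {n : ℕ} (hn : 2 ≤ n) : Nat.card (Quotient (crSim₂ n)) = 2 := by
  obtain ⟨⟨M, hM⟩, N, hN⟩ := exists_cr_sign hn
  rw [card_quotient_of_iff _ _ crSim₂_iff, show Set.range (fun M : Matching n => (-1 : ℤ) ^ M.cr) =
    {1, -1} from ?_, Set.ncard_pair (by norm_num)]
  ext z
  constructor
  · rintro ⟨P, rfl⟩
    exact neg_one_pow_eq_or ℤ P.cr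
  · rintro (rfl | rfl)
    exacts [⟨M, hM⟩, ⟨N, hN⟩]

theorem crSim₂_classes {n : ℕ} (hn : 2 ≤ n) :
    ∃ c₁ c₂ : Quotient (crSim₂ n), c₁ ≠ c₂ ∧
      ({M : Matching n | Quotient.mk (crSim₂ n) M = c₁}.ncard : ℚ)
        = ((Nat.doubleFactorial (2 * n - 1) : ℚ) + 1) / 2 ∧
      ({M : Matching n | Quotient.mk (crSim₂ n) M = c₂}.ncard : ℚ)
        = ((Nat.doubleFactorial (2 * n - 1) : ℚ) - 1) / 2 := by
  obtain ⟨⟨M, hM⟩, N, hN⟩ := exists_cr_sign hn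
  obtain ⟨h1, h2⟩ := card_cr_even_odd n
  refine ⟨Quotient.mk _ M, Quotient.mk _ N, fun h => ?_, ?_, ?_⟩
  · have := (crSim₂_iff M N).1 (Quotient.eq.1 h)
    rw [hM, hN] at this
    norm_num at this
  · rw [crSim₂_class, hM, eq_div_iff two_ne_zero]
    exact_mod_cast (by linarith : ({M : Matching n | (-1 : ℤ) ^ M.cr = 1}.ncard : ℤ) * 2 =
      Nat.doubleFactorial (2 * n - 1) + 1)
  · rw [crSim₂_class, hN, eq_div_iff two_ne_zero, eq_sub_iff_add_eq]
    exact_mod_cast (by linarith : ({M : Matching n | (-1 : ℤ) ^ M.cr = -1}.ncard : ℤ) * 2 + 1 =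
      Nat.doubleFactorial (2 * n - 1))

theorem card_matching_one : Fintype.card (Matching 1) = 1 := card_matching 1

theorem card_quotient_one (s : Setoid (Matching 1)) : Nat.card (Quotient s) = 1 := by
  obtain ⟨M, hM⟩ := Fintype.card_eq_one_iff.1 card_matching_one
  rw [Nat.card_eq_one_iff_exists]
  exact ⟨Quotient.mk s M, fun q => Quotient.inductionOn q fun N => by rw [hM N]⟩

/-! ### Values of the nesting invariant -/

/-- `inside` starts with $0,0$ and rises by steps of 0 or 1, so it takes every value up to the
current one. This bounds below the number of even gaps, by $2+\lfloor\mathrm{inside}/2\rfloor$, and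
that of odd gaps, by $\lceil\mathrm{inside}/2\rceil$. -/
theorem total_bounds {n : ℕ} (M : Matching (n + 1)) {m : ℕ} (hm : m + 1 ≤ 2 * (n + 1)) :
    2 * (M.inside (m + 1) / 2 : ℕ) + 4 ≤ M.gapSum (m + 2) + (m + 2) ∧
    M.gapSum (m + 2) + 2 * ((M.inside (m + 1) + 1) / 2 : ℕ) ≤ m + 2 ∧
    (M.gapSum (m + 2) + m) % 2 = 0 := by
  induction m with
  | zero =>
    rw [gapSum_succ, gapSum_succ, zero_add, gapSign_one, gapSum_zero, inside_one, gapSign_zero]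
    norm_num
  | succ m ih =>
    specialize ih (by omega)
    have hs : M.gapSign (m + 1 + 1) = if M.inside (m + 1 + 1) % 2 = 0 then 1 else -1 := by
      rw [gapSign]
      rcases Nat.mod_two_eq_zero_or_one (M.inside (m + 1 + 1)) with h | h
      · rw [(Nat.even_iff.2 h).neg_one_pow, if_pos h]
      · rw [(Nat.odd_iff.2 h).neg_one_pow, if_neg (by omega)]
    rw [show m + 1 + 2 = m + 2 + 1 by ring, gapSum_succ, show m + 2 = m + 1 + 1 by ring, hs]
    rw [show m + 2 = m + 1 + 1 by ring] at ih
    have := M.inside_step (k := m + 1) (by omega)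
    push_cast at ih ⊢
    split_ifs <;> omega

/-- The possible sums of gap signs. -/
theorem exists_total_eq {n : ℕ} (M : Matching (n + 1)) :
    ∃ a : ℕ, 1 ≤ a ∧ a ≤ n + 1 ∧ M.total = 2 * a - (n + 1) + (1 - ((n + 1) % 2 : ℕ)) := by
  obtain ⟨h1, h2, h3⟩ := M.total_bounds (m := 2 * n + 1) (by omega)
  have hi : M.inside (2 * n + 1 + 1) = n + 1 := M.inside_of_le
  rw [hi] at h1 h2
  change _ ≤ M.total + _ at h1
  change M.total + _ ≤ _ at h2
  change (M.total + _) % 2 = _ at h3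
  generalize M.total = t at *
  exact ⟨((t + (n + 1) - (1 - ((n + 1) % 2 : ℕ))) / 2).toNat, by omega, by omega, by omega⟩

theorem neType_child {n : ℕ} (M : Matching n) (x : Fin (2 * n + 1)) :
    (M.child x).neType = (M.neType.1 * M.gapSign x,
      1 + M.gapSum (x + 1) + M.gapSum x - M.neType.2) := by
  rw [neType, sign_child, total_child]; rfl

theorem neType_child_zero {n : ℕ} (M : Matching n) :
    (M.child 0).neType = (M.neType.1, 2 - M.neType.2) := by
  rw [neType_child]
  simp only [Fin.val_zero, gapSign_zero, gapSum_succ, gapSum_zero, mul_one]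
  norm_num

theorem neType_child_last {n : ℕ} (M : Matching n) :
    (M.child (Fin.last _)).neType = (M.neType.1 * (-1) ^ n, M.neType.2 + 1 - (-1) ^ n) := by
  have h := M.gapSum_succ (2 * n)
  rw [gapSign_last] at h
  rw [neType_child]
  simp only [Fin.val_last, gapSign_last]
  have ht : M.neType.2 = M.gapSum (2 * n + 1) := rfl
  rw [ht, h]
  congr 1
  ring

theorem neType_child_one {n : ℕ} (M : Matching (n + 1)) :
    (M.child 1).neType = (M.neType.1, 4 - M.neType.2) := by
  rw [neType_child]
  have h1 : ((1 : Fin (2 * (n + 1) + 1)) : ℕ) = 1 := rfl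
  simp only [h1, gapSum_succ, gapSum_zero, gapSign_zero, gapSign_one, mul_one]
  norm_num

theorem neType_one (M : Matching 1) : M.neType = (1, 1) := by
  obtain ⟨M, x, rfl⟩ := exists_child_eq M
  obtain rfl : x = 0 := Subsingleton.elim (α := Fin 1) _ _
  have h : M.neType = (1, 1) := by
    rw [neType, total, gapSum_succ, gapSum_zero, gapSign_zero, ne, edges_zero]
    simp
  rw [neType_child_zero, h]
  norm_num

/-- The value $(-1,1)$ is missing, which makes $n=2$ exceptional. -/
theorem range_neType_two :
    Set.range (neType : Matching 2 → _) = {(1, 1), (1, 3), (-1, 3)} := by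
  obtain ⟨M, -⟩ := Fintype.card_eq_one_iff.1 card_matching_one
  have h : ∀ M : Matching 1, (M.child 0).neType = (1, 1) ∧ (M.child 1).neType = (1, 3) ∧
      (M.child (Fin.last 2)).neType = (-1, 3) := by
    intro M
    rw [neType_child_zero, neType_child_one (n := 0) M, neType_child_last (n := 1) M, neType_one]
    norm_num
  ext z
  simp only [Set.mem_range, Set.mem_insert_iff, Set.mem_singleton_iff]
  constructor
  · rintro ⟨N, rfl⟩
    obtain ⟨N, x, rfl⟩ := exists_child_eq N
    obtain ⟨h0, h1, h2⟩ := h N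
    have hx : x = 0 ∨ x = 1 ∨ x = Fin.last 2 := by
      revert x; decide
    rcases hx with rfl | rfl | rfl
    exacts [Or.inl h0, Or.inr (Or.inl h1), Or.inr (Or.inr h2)]
  · obtain ⟨h0, h1, h2⟩ := h M
    rintro (rfl | rfl | rfl)
    exacts [⟨_, h0⟩, ⟨_, h1⟩, ⟨_, h2⟩]

theorem exists_neType_three {e t : ℤ} (he : e = 1 ∨ e = -1) (ht : t = -1 ∨ t = 1 ∨ t = 3) :
    ∃ M : Matching 3, M.neType = (e, t) := by
  have h2 : ∀ z ∈ ({(1, 1), (1, 3), (-1, 3)} : Set (ℤ × ℤ)), ∃ M : Matching 2, M.neType = z :=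
    fun z hz => by rwa [← range_neType_two] at hz
  -- Total 3 occurs with both signs for $n=2$; the maps $t\mapsto 2-t,\ 4-t,\ t$ on totals keep the
  -- sign and send 3 to $-1,1,3$.
  obtain ⟨M, hM⟩ := h2 (e, 3) (by rcases he with rfl | rfl <;> simp)
  rcases ht with rfl | rfl | rfl
  · exact ⟨M.child 0, by rw [neType_child_zero, hM]; norm_num⟩
  · exact ⟨M.child 1, by rw [neType_child_one (n := 1) M, hM]; norm_num⟩
  · exact ⟨M.child (Fin.last _), by rw [neType_child_last, hM]; norm_num⟩

theorem exists_neType_eq {n : ℕ} (hn : 3 ≤ n) {e : ℤ} (he : e = 1 ∨ e = -1) {a : ℕ}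
    (ha : 1 ≤ a) (han : a ≤ n) :
    ∃ M : Matching n, M.neType = (e, (2 * a - n + (1 - (n % 2 : ℕ)) : ℤ)) := by
  induction n, hn using Nat.le_induction generalizing e a with
  | base =>
    refine exists_neType_three he ?_
    norm_num
    omega
  | succ n hn ih =>
    rcases ha.eq_or_lt with rfl | ha
    · obtain ⟨M, hM⟩ := ih he (a := n) (by omega) le_rfl
      refine ⟨M.child 0, ?_⟩
      rw [neType_child_zero, hM]
      congr 1
      push_cast
      omega
    · obtain ⟨b, rfl⟩ : ∃ b, a = b + 1 := ⟨a - 1, by omega⟩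
      rcases Nat.even_or_odd n with hp | hp
      · obtain ⟨M, hM⟩ := ih he (a := b) (by omega) (by omega)
        refine ⟨M.child (Fin.last _), ?_⟩
        rw [neType_child_last, hM, hp.neg_one_pow, mul_one]
        have := Nat.even_iff.1 hp
        congr 1
        push_cast
        omega
      · obtain ⟨M, hM⟩ := ih (e := -e) (by omega) (a := b) (by omega) (by omega)
        refine ⟨M.child (Fin.last _), ?_⟩
        rw [neType_child_last, hM, hp.neg_one_pow, neg_mul_neg, mul_one]
        have := Nat.odd_iff.1 hp
        congr 1
        push_cast
        omega

theorem card_neSim₂ {n : ℕ} (hn : 3 ≤ n) : Nat.card (Quotient (neSim₂ n)) = 2 * n := by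
  have h : Set.range (neType : Matching n → _) = ((({1, -1} : Finset ℤ) ×ˢ
      (Icc 1 n).image fun a : ℕ => (2 * a - n + (1 - (n % 2 : ℕ)) : ℤ) : Finset (ℤ × ℤ)) :
      Set (ℤ × ℤ)) := by
    ext ⟨e, t⟩
    simp only [Set.mem_range, mem_coe, mem_product, mem_insert, mem_singleton, mem_image, mem_Icc]
    constructor
    · rintro ⟨M, hM⟩
      obtain ⟨rfl, rfl⟩ := Prod.mk.inj hM
      refine ⟨neg_one_pow_eq_or ℤ _, ?_⟩
      obtain ⟨k, rfl⟩ : ∃ k, n = k + 1 := ⟨n - 1, by omega⟩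
      obtain ⟨a, h1, h2, h3⟩ := M.exists_total_eq
      exact ⟨a, ⟨h1, h2⟩, by rw [h3]; push_cast; rfl⟩
    · rintro ⟨he, a, ⟨h1, h2⟩, rfl⟩
      exact exists_neType_eq hn he h1 h2
  rw [card_quotient_of_iff _ _ neSim₂_iff, h, Set.ncard_coe_finset, card_product,
    card_pair (by norm_num), card_image_of_injective _ (fun a b hab => by
      omega), Nat.card_Icc, Nat.add_sub_cancel]

end Matching

theorem mainTheorem7 :
    Nat.card (Quotient (Matching.crSim₂ 1)) = 1 ∧
    (∀ n : ℕ, 2 ≤ n →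
      Nat.card (Quotient (Matching.crSim₂ n)) = 2 ∧
      ∃ c₁ c₂ : Quotient (Matching.crSim₂ n), c₁ ≠ c₂ ∧
        ({M : Matching n | Quotient.mk (Matching.crSim₂ n) M = c₁}.ncard : ℚ)
          = ((Nat.doubleFactorial (2 * n - 1) : ℚ) + 1) / 2 ∧
        ({M : Matching n | Quotient.mk (Matching.crSim₂ n) M = c₂}.ncard : ℚ)
          = ((Nat.doubleFactorial (2 * n - 1) : ℚ) - 1) / 2) ∧
    Nat.card (Quotient (Matching.neSim₂ 1)) = 1 ∧
    Nat.card (Quotient (Matching.neSim₂ 2)) = 3 ∧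
    (∀ n : ℕ, 3 ≤ n → Nat.card (Quotient (Matching.neSim₂ n)) = 2 * n) := by
  refine ⟨Matching.card_quotient_one _,
    fun n hn => ⟨Matching.card_crSim₂ hn, Matching.crSim₂_classes hn⟩,
    Matching.card_quotient_one _, ?_, fun n hn => Matching.card_neSim₂ hn⟩
  rw [Matching.card_quotient_of_iff _ _ Matching.neSim₂_iff, Matching.range_neType_two,
    Set.ncard_eq_three]
  exact ⟨_, _, _, by norm_num, by norm_num, by norm_num, rfl⟩
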